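/- Theorem 15.1 (Whitney). Let $L$ be a finite geometric lattice, i.e. a finite bounded lattice in which every element is a join of points (atoms) and which is semimodular: whenever $a$ covers $a\wedge b$, the element $a\vee b$ covers $b$. Let $r(a)$ be the rank of $a\in L$ (the maximum length of a chain ending at $a$), let $\mu_L$ be the Möbius function of $L$, and let $\unlhd$ be a total order on the set of points of $L$. A set $T$ of points is independent if $r(\bigvee T)=|T|$, and dependent otherwise; a circuit is an inclusion-minimal dependent set of points; a broken circuit is a set obtained from a circuit by deleting its $\unlhd$-least element. The faces of the broken circuit complex $\mathrm{Br}(L)$ are the independent sets of points (including the empty set) that contain no broken circuit. Then for every integer $k\ge 0$, $$\bigl|\{T\in \mathrm{Br}(L) : |T|=k\}\bigr| \;=\; \sum_{a\in L:\ r(a)=k} (-1)^k\,\mu_L(0,a).$$ In particular, with $r=r(1)$ the rank of $L$, the number of faces of $\mathrm{Br}(L)$ with exactly $r$ points is $(-1)^{r}\mu_L(0,1)$. Moreover, these faces are exactly the faces of $\mathrm{Br}(L)$ of maximum cardinality, so $(-1)^r\mu_L(0,1)$ is the number of top-dimensional faces of the broken circuit complex. -/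

import Mathlib

namespace GeometricLattice

/-- A bounded lattice is geometric if it is (upper) semimodular and every element is a join of
points (atoms). -/
class IsGeometric (L : Type*) [Lattice L] [BoundedOrder L] : Prop where
  semimodular : IsUpperModularLattice L
  pointLattice : IsAtomistic L

/-- The points (atoms) of a lattice. -/
abbrev Point (L : Type*) [Lattice L] [BoundedOrder L] : Type _ := {p : L // IsAtom p}

variable {L : Type*} [Lattice L] [BoundedOrder L]

/-- The rank of `a`: the maximum length of a chain ending at `a`
(chains in a finite lattice have bounded length, so no information is lost by `toNat`). -/
noncomputable def rank (a : L) : ℕ := (Order.height a).toNat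

/-- The rank of a finite set of points, i.e. the rank of its join. -/
noncomputable def setRank (T : Finset (Point L)) : ℕ := rank (T.sup Subtype.val)

/-- A finite set of points is independent if its rank equals its cardinality. -/
def Indep (T : Finset (Point L)) : Prop := setRank T = T.card

/-- A circuit is an inclusion-minimal dependent set of points. -/
def IsCircuit (C : Finset (Point L)) : Prop := Minimal (fun T => ¬ Indep T) C

/-- A broken circuit, relative to the order `le` on points, is obtained from a circuit by
deleting its least element. -/
def IsBrokenCircuit (le : Point L → Point L → Prop) (B : Finset (Point L)) : Prop :=
  ∃ C : Finset (Point L), IsCircuit C ∧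
    ∃ p ∈ C, (∀ q ∈ C, le p q) ∧ (B : Set (Point L)) = (C : Set (Point L)) \ {p}

/-- The faces of the broken circuit complex: the independent sets of points that contain no
broken circuit. The empty set is a face. -/
def brokenCircuitComplex (le : Point L → Point L → Prop) : Set (Finset (Point L)) :=
  {T | Indep T ∧ ∀ B : Finset (Point L), IsBrokenCircuit le B → ¬ B ⊆ T}

/-- The faces of maximum dimension, i.e. of maximum cardinality. -/
def topFaces (le : Point L → Point L → Prop) : Set (Finset (Point L)) :=
  {T | T ∈ brokenCircuitComplex le ∧ ∀ U ∈ brokenCircuitComplex le, U.card ≤ T.card}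

end GeometricLattice

/-!
Deleting a point from a circuit does not change its join, so if `p` is the least point below `a`,
then no broken circuit with join at most `a` contains `p`. Hence the faces of `Br(L)` whose join is
at most `a ≠ 0` form a cone with apex `p`, and the sum of `(-1) ^ |T|` over them vanishes. By Möbius
inversion the sum over the faces `T` with join exactly `a` is `μ(0, a)`, and each of them has `r(a)`
points. A face with join `1` exists because the points not spanned by smaller points, the
lexicographically first basis, contain no broken circuit: the largest point of a circuit is spanned
by the others.
-/

open Finset Order

namespace GeometricLattice

theorem exists_forall_rel_of_finite {α : Type*} (r : α → α → Prop) [IsTrans α r] [Std.Total r]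
    {s : Set α} (hs : s.Finite) (hne : s.Nonempty) : ∃ m ∈ s, ∀ x ∈ s, r m x := by
  have := hs.to_subtype
  have := hne.to_subtype
  have := Fintype.ofFinite s
  obtain ⟨m, hm⟩ :=
    (Std.Total.directed (r := Function.swap r) (Subtype.val : s → α)).finset_le univ
  exact ⟨m, m.2, fun x hx => hm ⟨x, hx⟩ (mem_univ _)⟩

theorem sum_neg_one_pow_card_eq_zero_of_cone {α R : Type*} [DecidableEq α] [Ring R]
    {s : Finset (Finset α)} {p : α} (hinsert : ∀ T ∈ s, insert p T ∈ s)
    (herase : ∀ T ∈ s, T.erase p ∈ s) : ∑ T ∈ s, (-1 : R) ^ #T = 0 := by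
  refine sum_involution (fun T _ => if p ∈ T then T.erase p else insert p T) ?_ ?_ ?_ ?_
  · intro T _
    split_ifs with h
    · rw [← card_erase_add_one h, pow_succ, mul_neg_one, neg_add_cancel]
    · rw [card_insert_of_notMem h, pow_succ, mul_neg_one, add_neg_cancel]
  · intro T _ _
    split_ifs with h
    · exact erase_ne_self.2 h
    · exact insert_ne_self.2 h
  · intro T hT
    split_ifs
    exacts [herase T hT, hinsert T hT]
  · intro T _
    by_cases h : p ∈ T <;> simp [h]

theorem sum_fiber_eq_mu {P ι R : Type*} [PartialOrder P] [OrderBot P] [LocallyFiniteOrder P]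
    [DecidableEq P] [Ring R] {s : Finset ι} {g : ι → P} {w : ι → R}
    (h : ∀ a, ∑ i ∈ s with g i ∈ Iic a, w i = if a = ⊥ then 1 else 0) (a : P) :
    ∑ i ∈ s with g i = a, w i = IncidenceAlgebra.mu R ⊥ a := by
  rw [IncidenceAlgebra.moebius_inversion_bot (fun b => ∑ i ∈ s with g i = b, w i)
    (fun b => if b = ⊥ then 1 else 0)
    (fun b => by rw [← h b, sum_fiberwise_eq_sum_filter]) a]
  simp

section Graded

/-- Semimodularity propagates covers upwards, so this is proved by a direct induction for the
coheight but not for the height. -/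
theorem coheight_eq_add_one_of_covBy {α : Type*} [Lattice α] [IsUpperModularLattice α]
    [WellFoundedGT α] [IsStronglyAtomic α] {a b : α} (hab : a ⋖ b) :
    coheight a = coheight b + 1 := by
  induction a using WellFoundedGT.induction generalizing b with
  | _ a ih =>
    refine le_antisymm ?_ (coheight_add_one_le hab.lt)
    rw [coheight_eq_iSup_gt_coheight a]
    refine iSup₂_le fun y hy => ?_
    obtain ⟨c, hac, hcy⟩ := exists_covBy_le_of_lt hy
    suffices hcb : coheight c = coheight b by
      rw [← hcb]
      gcongr
    by_cases hne : c = b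
    · rw [hne]
    have hinf : c ⊓ b = a := hac.wcovBy.inf_eq hab.wcovBy hne
    have hc : c ⋖ c ⊔ b := covBy_sup_of_inf_covBy_right (hinf ▸ hab)
    have hb : b ⋖ c ⊔ b := covBy_sup_of_inf_covBy_left (hinf ▸ hac)
    rw [ih c hac.lt hc, ih b hab.lt hb]

theorem coheight_ne_top {α : Type*} [Lattice α] [OrderTop α] [IsUpperModularLattice α]
    [WellFoundedGT α] [IsStronglyAtomic α] (a : α) : coheight a ≠ ⊤ := by
  induction a using WellFoundedGT.induction with
  | _ a ih =>
    rcases eq_or_ne a ⊤ with rfl | ha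
    · simp
    · obtain ⟨b, hab, -⟩ := exists_covBy_le_of_lt ha.lt_top
      simpa [coheight_eq_add_one_of_covBy hab] using ih b hab.lt

theorem height_eq_of_covBy_add_one {α : Type*} [PartialOrder α] [OrderBot α] [WellFoundedLT α]
    [IsStronglyCoatomic α] {f : α → ℕ} (hbot : f ⊥ = 0) (hcov : ∀ a b, a ⋖ b → f b = f a + 1)
    (a : α) : height a = f a := by
  induction a using WellFoundedLT.induction with
  | _ a ih =>
    refine le_antisymm (height_le_coe_iff.2 fun y hy => ?_) ?_
    · obtain ⟨c, hyc, hca⟩ := exists_le_covBy_of_lt hy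
      calc height y ≤ height c := height_mono hyc
        _ = f c := ih c hca.lt
        _ < f a := by rw [hcov c a hca]; exact_mod_cast Nat.lt_succ_self _
    · rcases eq_or_ne a ⊥ with rfl | ha
      · simp [hbot]
      · obtain ⟨c, -, hca⟩ := exists_le_covBy_of_lt ha.bot_lt
        calc (f a : ℕ∞) = height c + 1 := by rw [hcov c a hca, ih c hca.lt, Nat.cast_add_one]
          _ ≤ height a := height_add_one_le hca.lt

theorem exists_nat_grade (L : Type*) [Lattice L] [BoundedOrder L] [IsUpperModularLattice L]
    [WellFoundedGT L] [IsStronglyAtomic L] :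
    ∃ f : L → ℕ, f ⊥ = 0 ∧ ∀ a b, a ⋖ b → f b = f a + 1 := by
  refine ⟨fun a => (coheight (⊥ : L)).toNat - (coheight a).toNat, Nat.sub_self _, fun a b hab => ?_⟩
  have hle : (coheight a).toNat ≤ (coheight (⊥ : L)).toNat :=
    ENat.toNat_le_toNat (coheight_anti bot_le) (coheight_ne_top _)
  have hsucc : (coheight a).toNat = (coheight b).toNat + 1 := by
    rw [coheight_eq_add_one_of_covBy hab, ENat.toNat_add (coheight_ne_top b) (by simp),
      ENat.toNat_one]
  dsimp only
  omega

end Graded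

section Rank

variable {L : Type*} [Lattice L] [BoundedOrder L]

theorem rank_bot : rank (⊥ : L) = 0 := by simp [rank]

variable [IsUpperModularLattice L] [WellFoundedLT L] [WellFoundedGT L]

theorem natCast_rank (a : L) : (rank a : ℕ∞) = height a := by
  obtain ⟨f, hbot, hcov⟩ := exists_nat_grade L
  rw [rank, height_eq_of_covBy_add_one hbot hcov, ENat.toNat_natCast]

theorem rank_strictMono : StrictMono (rank : L → ℕ) := fun a b hab => by
  have hlt := height_strictMono hab (natCast_rank a ▸ ENat.natCast_lt_top _)
  rw [← natCast_rank, ← natCast_rank] at hlt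
  exact_mod_cast hlt

theorem rank_eq_rank_top_iff {a : L} : rank a = rank (⊤ : L) ↔ a = ⊤ :=
  ⟨fun h => by_contra fun ha => (rank_strictMono (lt_top_iff_ne_top.2 ha)).ne h, congrArg rank⟩

theorem rank_sup_of_isAtom {p a : L} (hp : IsAtom p) (hpa : ¬ p ≤ a) :
    rank (p ⊔ a) = rank a + 1 := by
  obtain ⟨f, hbot, hcov⟩ := exists_nat_grade L
  have hrank (x : L) : rank x = f x := by
    exact_mod_cast (natCast_rank x).trans (height_eq_of_covBy_add_one hbot hcov x)
  have hcovBy : a ⋖ p ⊔ a := by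
    refine covBy_sup_of_inf_covBy_left ?_
    rw [(hp.not_le_iff_disjoint.1 hpa).eq_bot]
    exact hp.bot_covBy
  rw [hrank, hrank, hcov _ _ hcovBy]

theorem Indep.card_le_rank_top {T : Finset (Point L)} (hT : Indep T) : #T ≤ rank (⊤ : L) :=
  hT.symm.trans_le (rank_strictMono.monotone le_top)

end Rank

section Circuits

variable {L : Type*} [Lattice L] [BoundedOrder L]

theorem coe_le_sup {T : Finset (Point L)} {p : Point L} (hp : p ∈ T) :
    (p : L) ≤ T.sup Subtype.val := Finset.le_sup (f := Subtype.val) hp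

theorem indep_empty : Indep (∅ : Finset (Point L)) := by simp [Indep, setRank, rank_bot]

theorem exists_isCircuit_subset {T : Finset (Point L)} (hT : ¬ Indep T) : ∃ C ⊆ T, IsCircuit C :=
  exists_minimal_le_of_wellFoundedLT (fun U : Finset (Point L) => ¬ Indep U) T hT

theorem IsCircuit.nonempty {C : Finset (Point L)} (hC : IsCircuit C) : C.Nonempty :=
  nonempty_iff_ne_empty.2 fun h => hC.1 (h ▸ indep_empty)

variable [DecidableEq (Point L)]

theorem IsCircuit.indep_erase {C : Finset (Point L)} (hC : IsCircuit C) {p : Point L}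
    (hp : p ∈ C) : Indep (C.erase p) :=
  not_not.1 fun hdep => (erase_ssubset hp).not_ge (hC.2 hdep (erase_subset p C))

variable [IsUpperModularLattice L] [WellFoundedLT L] [WellFoundedGT L]

theorem Indep.insert {T : Finset (Point L)} (hT : Indep T) {p : Point L}
    (hp : ¬ (p : L) ≤ T.sup Subtype.val) : Indep (insert p T) := by
  rw [Indep, setRank, sup_insert, rank_sup_of_isAtom p.2 hp,
    card_insert_of_notMem fun hpT => hp (coe_le_sup hpT)]
  exact congrArg (· + 1) hT

theorem IsCircuit.le_sup_erase {C : Finset (Point L)} (hC : IsCircuit C) {p : Point L}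
    (hp : p ∈ C) : (p : L) ≤ (C.erase p).sup Subtype.val := by
  by_contra h
  exact hC.1 (insert_erase hp ▸ (hC.indep_erase hp).insert h)

theorem IsCircuit.le_sup_of_erase_subset {C T : Finset (Point L)} (hC : IsCircuit C) {p : Point L}
    (hp : p ∈ C) (h : C.erase p ⊆ T) {q : Point L} (hq : q ∈ C) :
    (q : L) ≤ T.sup Subtype.val := by
  rcases eq_or_ne q p with rfl | hqp
  · exact (hC.le_sup_erase hp).trans (sup_mono h)
  · exact coe_le_sup (h (mem_erase.2 ⟨hqp, hq⟩))

theorem IsCircuit.erase_nonempty {C : Finset (Point L)} (hC : IsCircuit C) {p : Point L}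
    (hp : p ∈ C) : (C.erase p).Nonempty := by
  refine nonempty_iff_ne_empty.2 fun h => p.2.1 (le_bot_iff.1 ?_)
  simpa [h] using hC.le_sup_erase hp

end Circuits

section Faces

variable {L : Type*} [Lattice L] [BoundedOrder L] {le : Point L → Point L → Prop}

/-- The lexicographically first basis of the points with respect to `le`: the points that are not
spanned by `le`-smaller ones. It is the witness that the broken circuit complex has a face that
spans all points. -/
def lexFirstBasis (le : Point L → Point L → Prop) : Set (Point L) :=
  {p | ∀ U : Finset (Point L), (∀ q ∈ U, le q p ∧ q ≠ p) → ¬ (p : L) ≤ U.sup Subtype.val}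

theorem le_sup_of_lexFirstBasis_subset [Finite (Point L)] [IsLinearOrder (Point L) le]
    {T : Finset (Point L)} (hT : lexFirstBasis le ⊆ T) (p : Point L) :
    (p : L) ≤ T.sup Subtype.val := by
  by_contra hp
  obtain ⟨m, hm, hmin⟩ := exists_forall_rel_of_finite le
    (Set.toFinite {q : Point L | ¬ (q : L) ≤ T.sup Subtype.val}) ⟨p, hp⟩
  refine hm (coe_le_sup (hT fun U hU hmU => hm (hmU.trans (Finset.sup_le fun q hq => ?_))))
  by_contra hqT
  exact (hU q hq).2 (antisymm_of le (hU q hq).1 (hmin q hqT))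

variable [IsLinearOrder (Point L) le]

/-- Independence is automatic on the right because a dependent set contains a circuit and hence a
broken circuit. -/
theorem mem_brokenCircuitComplex_iff [DecidableEq (Point L)] {T : Finset (Point L)} :
    T ∈ brokenCircuitComplex le ↔
      ∀ C, IsCircuit C → ∀ p ∈ C, (∀ q ∈ C, le p q) → ¬ C.erase p ⊆ T := by
  refine ⟨fun hT C hC p hp hmin => hT.2 _ ⟨C, hC, p, hp, hmin, coe_erase p C⟩,
    fun h => ⟨by_contra fun hdep => ?_, ?_⟩⟩
  · obtain ⟨C, hCT, hC⟩ := exists_isCircuit_subset hdep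
    obtain ⟨p, hp, hmin⟩ := exists_forall_rel_of_finite le C.finite_toSet hC.nonempty
    exact h C hC p hp hmin ((erase_subset p C).trans hCT)
  · rintro B ⟨C, hC, p, hp, hmin, hB⟩ hBT
    rw [← coe_erase, coe_inj] at hB
    exact h C hC p hp hmin (hB ▸ hBT)

theorem mem_brokenCircuitComplex_of_subset {T U : Finset (Point L)}
    (hT : T ∈ brokenCircuitComplex le) (hUT : U ⊆ T) : U ∈ brokenCircuitComplex le := by
  classical
  exact mem_brokenCircuitComplex_iff.2 fun C hC p hp hmin hCU =>
    mem_brokenCircuitComplex_iff.1 hT C hC p hp hmin (hCU.trans hUT)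

variable [IsUpperModularLattice L] [WellFoundedLT L] [WellFoundedGT L]

theorem insert_mem_brokenCircuitComplex [DecidableEq (Point L)] {T : Finset (Point L)} {a : L}
    (hT : T ∈ brokenCircuitComplex le) (hTa : T.sup Subtype.val ≤ a) {p : Point L}
    (hpa : (p : L) ≤ a) (hmin : ∀ q : Point L, (q : L) ≤ a → le p q) :
    insert p T ∈ brokenCircuitComplex le := by
  refine mem_brokenCircuitComplex_iff.2 fun C hC q hq hqmin hsub => ?_
  have hqa : (q : L) ≤ a := (hC.le_sup_of_erase_subset hq hsub hq).trans <| by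
    rw [sup_insert]
    exact sup_le hpa hTa
  have hpC : p ∉ C.erase q := fun hp =>
    ne_of_mem_erase hp (antisymm_of le (hmin q hqa) (hqmin p (mem_of_mem_erase hp)))
  exact mem_brokenCircuitComplex_iff.1 hT C hC q hq hqmin
    ((subset_insert_iff_of_notMem hpC).1 hsub)

theorem mem_brokenCircuitComplex_of_subset_lexFirstBasis {T : Finset (Point L)}
    (hT : (T : Set (Point L)) ⊆ lexFirstBasis le) : T ∈ brokenCircuitComplex le := by
  classical
  refine mem_brokenCircuitComplex_iff.2 fun C hC p hp hmin hsub => ?_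
  obtain ⟨m, hm, hmax⟩ := exists_forall_rel_of_finite (Function.swap le)
    (C.erase p).finite_toSet (hC.erase_nonempty hp)
  refine hT (hsub hm) (C.erase m) (fun q hq => ⟨?_, ne_of_mem_erase hq⟩)
    (hC.le_sup_erase (mem_of_mem_erase hm))
  rcases eq_or_ne q p with rfl | hqp
  · exact hmin m (mem_of_mem_erase hm)
  · exact hmax q (mem_coe.2 (mem_erase.2 ⟨hqp, mem_of_mem_erase hq⟩))

theorem empty_mem_brokenCircuitComplex : ∅ ∈ brokenCircuitComplex le :=
  mem_brokenCircuitComplex_of_subset_lexFirstBasis (by simp)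

theorem exists_mem_brokenCircuitComplex_sup_eq_top [Finite (Point L)]
    (h : IsLUB {p : L | IsAtom p} ⊤) :
    ∃ T ∈ brokenCircuitComplex le, T.sup Subtype.val = (⊤ : L) := by
  have hfin := (lexFirstBasis le).toFinite
  refine ⟨hfin.toFinset, mem_brokenCircuitComplex_of_subset_lexFirstBasis hfin.coe_toFinset.subset,
    top_le_iff.1 (h.2 fun p hp => ?_)⟩
  exact le_sup_of_lexFirstBasis_subset hfin.coe_toFinset.superset ⟨p, hp⟩

theorem topFaces_eq [Finite (Point L)] (h : IsLUB {p : L | IsAtom p} ⊤) :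
    topFaces le = {T ∈ brokenCircuitComplex le | #T = rank (⊤ : L)} := by
  ext T
  constructor
  · rintro ⟨hT, hmax⟩
    obtain ⟨U, hU, hUtop⟩ := exists_mem_brokenCircuitComplex_sup_eq_top (le := le) h
    refine ⟨hT, hT.1.card_le_rank_top.antisymm ?_⟩
    calc rank (⊤ : L) = setRank U := by rw [setRank, hUtop]
      _ = #U := hU.1
      _ ≤ #T := hmax U hU
  · rintro ⟨hT, hcard⟩
    exact ⟨hT, fun U hU => hU.1.card_le_rank_top.trans_eq hcard.symm⟩

end Faces

section Counting

variable {L : Type*} [Lattice L] [BoundedOrder L] [Finite L]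
  {le : Point L → Point L → Prop}

/-- The broken circuit complex as a `Finset`, to sum over its faces. -/
noncomputable def faces (le : Point L → Point L → Prop) : Finset (Finset (Point L)) :=
  (brokenCircuitComplex le).toFinite.toFinset

theorem mem_faces {T : Finset (Point L)} : T ∈ faces le ↔ T ∈ brokenCircuitComplex le :=
  Set.Finite.mem_toFinset _

variable [IsUpperModularLattice L] [LocallyFiniteOrder L] [DecidableEq L]
  [IsLinearOrder (Point L) le]

theorem sum_faces_sup_le_bot :
    ∑ T ∈ faces le with T.sup Subtype.val ∈ Iic (⊥ : L), (-1 : ℤ) ^ #T = 1 := by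
  have hfilter : {T ∈ faces le | T.sup Subtype.val ∈ Iic (⊥ : L)} = {∅} := by
    refine eq_singleton_iff_unique_mem.2
      ⟨by simp [mem_faces, empty_mem_brokenCircuitComplex], fun T hT => ?_⟩
    refine eq_empty_of_forall_notMem fun p hp => p.2.1 (le_bot_iff.1 ?_)
    exact (coe_le_sup hp).trans (mem_Iic.1 (mem_filter.1 hT).2)
  simp [hfilter]

theorem sum_faces_sup_le_of_ne_bot {a : L} (ha : a ≠ ⊥) :
    ∑ T ∈ faces le with T.sup Subtype.val ∈ Iic a, (-1 : ℤ) ^ #T = 0 := by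
  obtain ⟨p₀, hp₀, hp₀a⟩ := (eq_bot_or_exists_atom_le a).resolve_left ha
  obtain ⟨p, hpa, hmin⟩ := exists_forall_rel_of_finite le
    (Set.toFinite {p : Point L | (p : L) ≤ a}) ⟨⟨p₀, hp₀⟩, hp₀a⟩
  refine sum_neg_one_pow_card_eq_zero_of_cone (p := p) (fun T hT => ?_) (fun T hT => ?_)
  all_goals
    simp only [mem_filter, mem_faces, mem_Iic] at hT ⊢
  · refine ⟨insert_mem_brokenCircuitComplex hT.1 hT.2 hpa hmin, ?_⟩
    rw [sup_insert]
    exact sup_le hpa hT.2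
  · exact ⟨mem_brokenCircuitComplex_of_subset hT.1 (erase_subset p T),
      (sup_mono (erase_subset p T)).trans hT.2⟩

theorem sum_faces_sup_eq_mu (a : L) :
    ∑ T ∈ faces le with T.sup Subtype.val = a, (-1 : ℤ) ^ #T = IncidenceAlgebra.mu ℤ ⊥ a := by
  refine sum_fiber_eq_mu (fun b => ?_) a
  split_ifs with hb
  · rw [hb, sum_faces_sup_le_bot]
  · exact sum_faces_sup_le_of_ne_bot hb

end Counting

section Whitney

variable {L : Type*} [Lattice L] [BoundedOrder L] [DecidableEq L] [LocallyFiniteOrder L]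
  [IsUpperModularLattice L] {le : Point L → Point L → Prop} [IsLinearOrder (Point L) le]

theorem ncard_faces_card_eq [Fintype L] (k : ℕ) :
    ({T ∈ brokenCircuitComplex le | #T = k}.ncard : ℤ) =
      ∑ a : L with rank a = k, (-1) ^ k * IncidenceAlgebra.mu ℤ ⊥ a := by
  have hrank (T) : T ∈ brokenCircuitComplex le ∧ #T = k ↔
      T ∈ faces le ∧ rank (T.sup Subtype.val) = k := by
    rw [mem_faces]
    exact and_congr_right fun hT => by rw [← hT.1, setRank]
  have hfaces : {T ∈ brokenCircuitComplex le | #T = k} =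
      ↑({T ∈ faces le | T.sup Subtype.val ∈ ({a | rank a = k} : Finset L)}) := by
    ext T
    simpa using hrank T
  calc ({T ∈ brokenCircuitComplex le | #T = k}.ncard : ℤ)
      = ∑ T ∈ faces le with T.sup Subtype.val ∈ ({a | rank a = k} : Finset L), 1 := by
        rw [hfaces, Set.ncard_coe_finset, card_eq_sum_ones, Nat.cast_sum, Nat.cast_one]
    _ = ∑ T ∈ faces le with T.sup Subtype.val ∈ ({a | rank a = k} : Finset L),
          (-1) ^ k * (-1 : ℤ) ^ #T := by
        refine sum_congr rfl fun T hT => ?_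
        rw [((hrank T).2 (by simpa using hT)).2, ← mul_pow, neg_one_mul, neg_neg, one_pow]
    _ = ∑ a : L with rank a = k, ∑ T ∈ faces le with T.sup Subtype.val = a,
          (-1) ^ k * (-1 : ℤ) ^ #T := (sum_fiberwise_eq_sum_filter _ _ _ _).symm
    _ = ∑ a : L with rank a = k, (-1) ^ k * IncidenceAlgebra.mu ℤ ⊥ a := by
        simp only [← mul_sum, sum_faces_sup_eq_mu]

theorem ncard_faces_card_eq_rank_top [Finite L] :
    ({T ∈ brokenCircuitComplex le | #T = rank (⊤ : L)}.ncard : ℤ) =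
      (-1) ^ rank (⊤ : L) * IncidenceAlgebra.mu ℤ (⊥ : L) ⊤ := by
  have := Fintype.ofFinite L
  simp [ncard_faces_card_eq, rank_eq_rank_top_iff, filter_eq']

end Whitney

end GeometricLattice

open GeometricLattice in
theorem theorem15p1_general {L : Type*} [Lattice L] [BoundedOrder L] [Fintype L] [DecidableEq L]
    [LocallyFiniteOrder L] [IsUpperModularLattice L]
    (h : IsLUB {p : L | IsAtom p} ⊤) (le : Point L → Point L → Prop)
    [IsLinearOrder (Point L) le] :
    (∀ k : ℕ,
      (({T ∈ brokenCircuitComplex le | T.card = k}.ncard : ℕ) : ℤ) =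
        ∑ a : L with rank a = k, (-1) ^ k * IncidenceAlgebra.mu ℤ (⊥ : L) a) ∧
    (({T ∈ brokenCircuitComplex le | T.card = rank (⊤ : L)}.ncard : ℕ) : ℤ) =
        (-1) ^ rank (⊤ : L) * IncidenceAlgebra.mu ℤ (⊥ : L) ⊤ ∧
    topFaces le = {T ∈ brokenCircuitComplex le | T.card = rank (⊤ : L)} ∧
    (((topFaces le).ncard : ℕ) : ℤ) =
        (-1) ^ rank (⊤ : L) * IncidenceAlgebra.mu ℤ (⊥ : L) ⊤ :=
  ⟨ncard_faces_card_eq, ncard_faces_card_eq_rank_top, topFaces_eq h,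
    topFaces_eq (le := le) h ▸ ncard_faces_card_eq_rank_top⟩

theorem theorem15p1 {L : Type*} [Lattice L] [BoundedOrder L] [Fintype L] [DecidableEq L]
    [LocallyFiniteOrder L] [GeometricLattice.IsGeometric L]
    (le : GeometricLattice.Point L → GeometricLattice.Point L → Prop)
    [IsLinearOrder (GeometricLattice.Point L) le] :
    (∀ k : ℕ,
      (({T ∈ GeometricLattice.brokenCircuitComplex le | T.card = k}.ncard : ℕ) : ℤ) =
        ∑ a : L with GeometricLattice.rank a = k, (-1) ^ k * IncidenceAlgebra.mu ℤ (⊥ : L) a) ∧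
    (({T ∈ GeometricLattice.brokenCircuitComplex le |
          T.card = GeometricLattice.rank (⊤ : L)}.ncard : ℕ) : ℤ) =
        (-1) ^ GeometricLattice.rank (⊤ : L) * IncidenceAlgebra.mu ℤ (⊥ : L) ⊤ ∧
    GeometricLattice.topFaces le =
      {T ∈ GeometricLattice.brokenCircuitComplex le |
        T.card = GeometricLattice.rank (⊤ : L)} ∧
    (((GeometricLattice.topFaces le).ncard : ℕ) : ℤ) =
        (-1) ^ GeometricLattice.rank (⊤ : L) * IncidenceAlgebra.mu ℤ (⊥ : L) ⊤ := by
  have : IsUpperModularLattice L := GeometricLattice.IsGeometric.semimodular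
  have : IsAtomistic L := GeometricLattice.IsGeometric.pointLattice
  exact theorem15p1_general isLUB_atoms_top le
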